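/- Let $V$ be a finite-dimensional vector space over a field $F$ (of arbitrary characteristic) with a quadratic form $Q\colon V\to F$ (the zero form is allowed), let $B(x,y)=Q(x+y)-Q(x)-Q(y)$, and let $V^\perp=\{x\in V\mid B(x,y)=0\text{ for all }y\in V\}$ be the radical of $B$. Let $\mathrm{Cl}(V,Q)=\mathrm{Cl}_0\oplus\mathrm{Cl}_1$ be the Clifford algebra (with $x^2=Q(x)$ for $x\in V$) with its even and odd parts, and let $\sigma$ be its main involution, i.e. the algebra endomorphism with $x\mapsto -x$ for $x\in V$. Let $\mathrm{Lip}(V,Q)$ be the multiplicative submonoid of $\mathrm{Cl}(V,Q)$ generated by $F$, $V$ and all $1+st$ with $s,t\in V$, $Q(s)=Q(t)=B(s,t)=0$, and let $\mathrm{Lip}^\times(V,Q)$ be the group of its invertible elements. Let $\mathcal G=\{Fp\mid p\in\mathrm{Lip}^\times(V,Q)\}$, a set of points (one-dimensional subspaces) of the projective space on $\mathrm{Cl}(V,Q)$ that is a group under $(Fp)(Fq)=F(pq)$; for $i\in\{0,1\}$ let $\mathcal G_i$ be the set of those points of $\mathcal G$ that are contained in $\mathrm{Cl}_i$. Let $\mathrm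 O'(V,Q)$ be the group of all isometries of $(V,Q)$ onto itself that fix $V^\perp$ elementwise, let $\mathrm I'(V,Q)=\mathrm O'(V,Q)\cap\{\mathrm{id}_V,-\mathrm{id}_V\}$ and $\mathrm{PO}'(V,Q)=\mathrm O'(V,Q)/\mathrm I'(V,Q)$. Let $\theta\colon\mathcal G\to\mathrm{PO}'(V,Q)$ be the homomorphism that sends $Fp$ to the class of $\xi_p\colon x\mapsto p\,x\,\sigma(p)^{-1}$. Suppose that $\dim V^\perp=1$. Then $\theta$ is surjective and has the following properties. (a) If $Q(V^\perp)=\{0\}$, then $\ker\theta=\{F1\}$. (b) If $Q(V^\perp)=\{0\}$ and $\dim V=1$, then $\mathcal G_0=\mathcal G$. (c) If $Q(V^\perp)=\{0\}$ and $\dim V>1$, then $\theta(\mathcal G_0)\neq\mathrm{PO}'(V,Q)$. (d) If $Q(V^\perp)\neq\{0\}$, then there is a vector $r\in V^\perp$ with $Q(r)\neq0$ such that $\ker\theta=\{F1,Fr\}$, where $F1\neq Fr$, $F1\in\mathcal G_0$ and $Fr\in\mathcal G_1$. Furthermore, $\theta(\mathcal G_0)=\mathrm{PO}'(V,Q)$.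 -/

import Mathlib

open scoped LinearAlgebra.Projectivization

noncomputable section

namespace ProjMetric

open CliffordAlgebra

variable {F V : Type*} [Field F] [AddCommGroup V] [Module F V] (Q : QuadraticForm F V)

/-! ### The radical and the weak orthogonal group -/

/-- The radical of the polar form `B(x, y) = Q (x + y) - Q x - Q y`, that is, the subspace of all
vectors orthogonal to every vector of `V`. (`Q` need not vanish on it in characteristic two.) -/
def polarRadical : Submodule F V := LinearMap.ker Q.polarBilin

/-- The weak orthogonal group: all isometries of `(V, Q)` onto itself that fix the radical
elementwise. -/
def weakOrthogonalGroup : Subgroup (V ≃ₗ[F] V) where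
  carrier := {φ | (∀ x, Q (φ x) = Q x) ∧ ∀ x ∈ polarRadical Q, φ x = x}
  one_mem' := ⟨fun _ => rfl, fun _ _ => rfl⟩
  mul_mem' := by
    rintro a b ⟨ha, ha'⟩ ⟨hb, hb'⟩
    refine ⟨fun x => ?_, fun x hx => ?_⟩
    · rw [LinearEquiv.mul_apply, ha, hb]
    · rw [LinearEquiv.mul_apply, hb' x hx, ha' x hx]
  inv_mem' := by
    rintro a ⟨ha, ha'⟩
    have key : ∀ x, a (a⁻¹ x) = x := fun x => a.apply_symm_apply x
    refine ⟨fun x => ?_, fun x hx => ?_⟩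
    · rw [← ha, key]
    · apply a.injective
      rw [key, ha' x hx]

/-- The subgroup of the weak orthogonal group consisting of those of its elements that
are `id` or `-id`. -/
def weakScalars : Subgroup (weakOrthogonalGroup Q) where
  carrier := {φ | (∀ x, (φ : V ≃ₗ[F] V) x = x) ∨ (∀ x, (φ : V ≃ₗ[F] V) x = -x)}
  one_mem' := Or.inl fun _ => rfl
  mul_mem' := by
    rintro a b (ha | ha) (hb | hb) <;> simp [LinearEquiv.mul_apply, ha, hb]
  inv_mem' := by
    rintro a (ha | ha)
    · refine Or.inl fun x => (a : V ≃ₗ[F] V).injective ?_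
      rw [ha x]; exact (a : V ≃ₗ[F] V).apply_symm_apply x
    · refine Or.inr fun x => (a : V ≃ₗ[F] V).injective ?_
      rw [ha (-x), neg_neg]; exact (a : V ≃ₗ[F] V).apply_symm_apply x

instance weakScalars_normal : (weakScalars Q).Normal where
  conj_mem := by
    rintro n (hn | hn) g
    · refine Or.inl fun x => ?_
      change (g : V ≃ₗ[F] V) ((n : V ≃ₗ[F] V) ((g : V ≃ₗ[F] V).symm x)) = x
      rw [hn, LinearEquiv.apply_symm_apply]
    · refine Or.inr fun x => ?_
      change (g : V ≃ₗ[F] V) ((n : V ≃ₗ[F] V) ((g : V ≃ₗ[F] V).symm x)) = -x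
      rw [hn, map_neg, LinearEquiv.apply_symm_apply]

/-- The projective weak orthogonal group. -/
abbrev ProjWeakOrthogonalGroup : Type _ := weakOrthogonalGroup Q ⧸ weakScalars Q

/-! ### Injectivity of the embeddings of `F` and `V` into the Clifford algebra -/

theorem exists_linearEquiv_exteriorAlgebra :
    ∃ e : CliffordAlgebra Q ≃ₗ[F] ExteriorAlgebra F V,
      (∀ c, e (algebraMap F _ c) = algebraMap F _ c) ∧ ∀ x, e (ι Q x) = ExteriorAlgebra.ι F x := by
  obtain ⟨B, hB⟩ := LinearMap.BilinMap.toQuadraticMap_surjective (0 - Q)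
  exact ⟨changeFormEquiv hB, fun c => changeForm_algebraMap hB c, fun x => changeForm_ι hB x⟩

theorem algebraMap_inj : Function.Injective (algebraMap F (CliffordAlgebra Q)) := by
  obtain ⟨e, he, -⟩ := exists_linearEquiv_exteriorAlgebra Q
  intro a b h
  have h2 := congrArg e h
  rw [he, he] at h2
  exact (ExteriorAlgebra.algebraMap_leftInverse V).injective h2

theorem ι_inj : Function.Injective (ι Q) := by
  obtain ⟨e, -, he⟩ := exists_linearEquiv_exteriorAlgebra Q
  intro a b h
  have h2 := congrArg e h
  rw [he, he] at h2
  exact ExteriorAlgebra.ι_leftInverse.injective h2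

instance nontrivial_clifford : Nontrivial (CliffordAlgebra Q) :=
  (algebraMap_inj Q).nontrivial

/-! ### The Lipschitz monoid and the Lipschitz group -/

/-- The Lipschitz monoid: the multiplicative submonoid of the Clifford algebra generated by `F`,
`V` and all `1 + s t` with `s, t ∈ V`, `Q s = Q t = B(s, t) = 0`. -/
def lipschitzMonoid : Submonoid (CliffordAlgebra Q) :=
  Submonoid.closure
    (Set.range (algebraMap F (CliffordAlgebra Q)) ∪ Set.range (ι Q) ∪
      {m | ∃ s t : V, Q s = 0 ∧ Q t = 0 ∧ QuadraticMap.polar Q s t = 0 ∧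
        m = 1 + ι Q s * ι Q t})

variable {Q}

theorem lipschitz_induction {P : CliffordAlgebra Q → Prop}
    (hF : ∀ c, P (algebraMap F _ c)) (hV : ∀ x, P (ι Q x))
    (hst : ∀ s t : V, Q s = 0 → Q t = 0 → QuadraticMap.polar Q s t = 0 →
      P (1 + ι Q s * ι Q t))
    (hmul : ∀ m n, P m → P n → P (m * n)) {m : CliffordAlgebra Q}
    (hm : m ∈ lipschitzMonoid Q) : P m := by
  induction hm using Submonoid.closure_induction with
  | mem x hx =>
    obtain (⟨c, rfl⟩ | ⟨v, rfl⟩) | ⟨s, t, hs, ht, h, rfl⟩ := hx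
    exacts [hF c, hV v, hst s t hs ht h]
  | one => simpa using hF 1
  | mul a b _ _ ha hb => exact hmul a b ha hb

theorem ι_mul_ι_eq_neg {s t : V} (h : QuadraticMap.polar Q s t = 0) :
    ι Q s * ι Q t = -(ι Q t * ι Q s) := by
  rw [eq_neg_iff_add_eq_zero, ι_mul_ι_add_swap, h, map_zero]

theorem ι_mul_self_eq_zero {s : V} (h : Q s = 0) : ι Q s * ι Q s = 0 := by
  rw [ι_sq_scalar, h, map_zero]

theorem reverse_mem_lipschitz {m : CliffordAlgebra Q} (hm : m ∈ lipschitzMonoid Q) :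
    reverse m ∈ lipschitzMonoid Q := by
  refine lipschitz_induction (P := fun m => reverse m ∈ lipschitzMonoid Q)
    (fun c => ?_) (fun x => ?_) (fun s t hs ht h => ?_) (fun a b ha hb => ?_) hm
  · rw [reverse.commutes]; exact Submonoid.subset_closure (Or.inl (Or.inl ⟨c, rfl⟩))
  · rw [reverse_ι]; exact Submonoid.subset_closure (Or.inl (Or.inr ⟨x, rfl⟩))
  · refine Submonoid.subset_closure (Or.inr ⟨t, s, ht, hs, ?_, ?_⟩)
    · rw [QuadraticMap.polar_comm, h]
    · simp
  · rw [reverse.map_mul]; exact mul_mem hb ha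

theorem mul_reverse_lipschitz {m : CliffordAlgebra Q} (hm : m ∈ lipschitzMonoid Q) :
    ∃ c : F, m * reverse m = algebraMap F _ c := by
  refine lipschitz_induction (P := fun m => ∃ c : F, m * reverse m = algebraMap F _ c)
    (fun c => ?_) (fun x => ?_) (fun s t hs ht h => ?_) ?_ hm
  · exact ⟨c * c, by rw [reverse.commutes, map_mul]⟩
  · exact ⟨Q x, by rw [reverse_ι, ι_sq_scalar]⟩
  · refine ⟨1, ?_⟩
    have e1 := ι_mul_ι_eq_neg h
    have e2 := ι_mul_self_eq_zero ht
    have e3 : ι Q s * ι Q t * (ι Q t * ι Q s) = 0 := by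
      rw [mul_assoc, ← mul_assoc (ι Q t), e2]; simp
    simp only [map_add, reverse.map_one, reverse.map_mul, reverse_ι, map_one]
    rw [mul_add, add_mul, add_mul, e3, e1]
    simp
  · rintro a b ⟨c, hc⟩ ⟨d, hd⟩
    refine ⟨d * c, ?_⟩
    rw [reverse.map_mul, mul_assoc, ← mul_assoc b, hd, Algebra.left_comm, hc, ← map_mul]

theorem lipschitz_conj_ι {m : CliffordAlgebra Q} (hm : m ∈ lipschitzMonoid Q) :
    ∀ x, ∃ y, m * ι Q x * reverse m = ι Q y := by
  refine lipschitz_induction (P := fun m => ∀ x, ∃ y, m * ι Q x * reverse m = ι Q y)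
    (fun c x => ?_) (fun v x => ?_) (fun s t hs ht h x => ?_) ?_ hm
  · refine ⟨c • c • x, ?_⟩
    rw [reverse.commutes, ← Algebra.commutes, ← Algebra.smul_def, ← Algebra.smul_def, map_smul,
      map_smul]
  · exact ⟨QuadraticMap.polar Q v x • v - Q v • x, by rw [reverse_ι, ι_mul_ι_mul_ι]⟩
  · refine ⟨x + QuadraticMap.polar Q t x • s - QuadraticMap.polar Q s x • t, ?_⟩
    have hst := ι_mul_ι_eq_neg h
    have hss := ι_mul_self_eq_zero hs
    have htt := ι_mul_self_eq_zero ht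
    have htx : ι Q t * ι Q x = algebraMap F _ (QuadraticMap.polar Q t x) - ι Q x * ι Q t :=
      eq_sub_of_add_eq (ι_mul_ι_add_swap t x)
    have hsx : ι Q s * ι Q x = algebraMap F _ (QuadraticMap.polar Q s x) - ι Q x * ι Q s :=
      eq_sub_of_add_eq (ι_mul_ι_add_swap s x)
    have e1 : ι Q s * ι Q t * ι Q x = QuadraticMap.polar Q t x • ι Q s
        - QuadraticMap.polar Q s x • ι Q t + ι Q x * (ι Q s * ι Q t) := by
      rw [mul_assoc, htx, mul_sub, ← mul_assoc, hsx, sub_mul, ← Algebra.commutes,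
        ← Algebra.smul_def, ← Algebra.smul_def, mul_assoc]
      abel
    have e2 : ι Q s * ι Q t * (ι Q t * ι Q s) = 0 := by
      rw [mul_assoc, ← mul_assoc (ι Q t), htt]; simp
    have e3 : ι Q s * (ι Q t * ι Q s) = 0 := by
      rw [← neg_eq_iff_eq_neg.mpr hst, mul_neg, ← mul_assoc, hss]; simp
    have e4 : ι Q t * (ι Q t * ι Q s) = 0 := by
      rw [← mul_assoc, htt]; simp
    have e5 : ι Q s * ι Q t * ι Q x * (ι Q t * ι Q s) = 0 := by
      rw [e1, add_mul, sub_mul, smul_mul_assoc, smul_mul_assoc, e3, e4, mul_assoc, e2]; simp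
    simp only [map_add, map_sub, map_smul, reverse.map_one, reverse.map_mul, reverse_ι]
    rw [mul_add, add_mul, add_mul, add_mul, mul_one, one_mul, mul_one, e5, e1, hst]
    noncomm_ring
  · intro a b ha hb x
    obtain ⟨y, hy⟩ := hb x
    obtain ⟨z, hz⟩ := ha y
    refine ⟨z, ?_⟩
    rw [← hz, ← hy, reverse.map_mul]
    simp only [mul_assoc]

theorem lipschitz_homogeneous {m : CliffordAlgebra Q} (hm : m ∈ lipschitzMonoid Q) :
    m ∈ evenOdd Q 0 ∨ m ∈ evenOdd Q 1 := by
  have hone : (1 : CliffordAlgebra Q) ∈ evenOdd Q 0 :=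
    Submodule.one_le.mp (one_le_evenOdd_zero Q)
  refine lipschitz_induction (P := fun m => m ∈ evenOdd Q 0 ∨ m ∈ evenOdd Q 1)
    (fun c => ?_) (fun x => ?_) (fun s t hs ht h => ?_) ?_ hm
  · left; rw [Algebra.algebraMap_eq_smul_one]; exact Submodule.smul_mem _ _ hone
  · exact Or.inr (ι_mem_evenOdd_one Q x)
  · exact Or.inl (Submodule.add_mem _ hone (ι_mul_ι_mem_evenOdd_zero Q s t))
  · have hmul : ∀ (i j k : ZMod 2) (a b : CliffordAlgebra Q), i + j = k → a ∈ evenOdd Q i →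
        b ∈ evenOdd Q j → a * b ∈ evenOdd Q k := fun i j k a b h ha hb =>
      h ▸ evenOdd_mul_le Q i j (Submodule.mul_mem_mul ha hb)
    rintro a b (ha | ha) (hb | hb)
    · exact Or.inl (hmul 0 0 0 a b (by decide) ha hb)
    · exact Or.inr (hmul 0 1 1 a b (by decide) ha hb)
    · exact Or.inr (hmul 1 0 1 a b (by decide) ha hb)
    · exact Or.inl (hmul 1 1 0 a b (by decide) ha hb)

theorem inv_eq_of_lipschitz (p : (CliffordAlgebra Q)ˣ) (hp : (p : CliffordAlgebra Q) ∈ lipschitzMonoid Q) :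
    ∃ c : F, (↑p⁻¹ : CliffordAlgebra Q) = algebraMap F _ c * reverse (p : CliffordAlgebra Q) := by
  obtain ⟨c, hc⟩ := mul_reverse_lipschitz hp
  have hrev : (↑p⁻¹ : CliffordAlgebra Q) * algebraMap F _ c = reverse (p : CliffordAlgebra Q) := by
    rw [← hc, Units.inv_mul_cancel_left]
  have hr : reverse (↑p⁻¹ : CliffordAlgebra Q) * reverse (p : CliffordAlgebra Q) = 1 := by
    rw [← reverse.map_mul, Units.mul_inv, reverse.map_one]
  have hc0 : c ≠ 0 := by
    rintro rfl
    rw [map_zero, mul_zero] at hrev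
    rw [← hrev, mul_zero] at hr
    exact zero_ne_one hr
  refine ⟨c⁻¹, ?_⟩
  rw [← hrev, Algebra.commutes, mul_assoc, ← map_mul, mul_inv_cancel₀ hc0, map_one, mul_one]

variable (Q)

/-- The Lipschitz group: the group of all invertible elements of the Lipschitz monoid. -/
def lipschitzGroup : Subgroup (CliffordAlgebra Q)ˣ where
  carrier := {p | (p : CliffordAlgebra Q) ∈ lipschitzMonoid Q}
  one_mem' := one_mem (lipschitzMonoid Q)
  mul_mem' := fun ha hb => (lipschitzMonoid Q).mul_mem ha hb
  inv_mem' := by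
    intro p hp
    obtain ⟨c, hc⟩ := inv_eq_of_lipschitz p hp
    change (↑p⁻¹ : CliffordAlgebra Q) ∈ lipschitzMonoid Q
    rw [hc]
    exact mul_mem (Submonoid.subset_closure (Or.inl (Or.inl ⟨c, rfl⟩))) (reverse_mem_lipschitz hp)

/-- The underlying element of the Clifford algebra. -/
abbrev elt {Q : QuadraticForm F V} (p : lipschitzGroup Q) : CliffordAlgebra Q :=
  ((p : (CliffordAlgebra Q)ˣ) : CliffordAlgebra Q)

/-- The main involution, on units. -/
def involuteUnits : (CliffordAlgebra Q)ˣ →* (CliffordAlgebra Q)ˣ :=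
  Units.map (involute (Q := Q) : CliffordAlgebra Q →* CliffordAlgebra Q)

variable {Q}

@[simp] theorem coe_involuteUnits (p : (CliffordAlgebra Q)ˣ) :
    (involuteUnits Q p : CliffordAlgebra Q) = involute (p : CliffordAlgebra Q) := rfl

/-! ### The twisted adjoint representation -/

/-- For `p` in the Lipschitz group and `x ∈ V`, the element `p x σ(p)⁻¹` is a vector. -/
theorem exists_twist (p : lipschitzGroup Q) (x : V) :
    ∃ y, ι Q y = elt p * ι Q x * ↑(involuteUnits Q p)⁻¹ := by
  obtain ⟨c, hc⟩ := inv_eq_of_lipschitz p.1 p.2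
  obtain ⟨y, hy⟩ := lipschitz_conj_ι p.2 x
  have key : elt p * ι Q x * ↑(p : (CliffordAlgebra Q)ˣ)⁻¹ = ι Q (c • y) := by
    rw [hc, Algebra.commutes, ← mul_assoc, hy, ← Algebra.commutes, ← Algebra.smul_def, map_smul]
  rcases lipschitz_homogeneous p.2 with h | h
  · have : involuteUnits Q p = p := Units.ext (involute_eq_of_mem_even h)
    exact ⟨c • y, by rw [this, key]⟩
  · have : involuteUnits Q p = -p := Units.ext (involute_eq_of_mem_odd h)
    exact ⟨-(c • y), by rw [this, map_neg, ← key, inv_neg, Units.val_neg, mul_neg]⟩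

/-- The vector `p x σ(p)⁻¹`. -/
def twist (p : lipschitzGroup Q) (x : V) : V := (exists_twist p x).choose

theorem ι_twist (p : lipschitzGroup Q) (x : V) :
    ι Q (twist p x) = elt p * ι Q x * ↑(involuteUnits Q p)⁻¹ := (exists_twist p x).choose_spec

theorem twist_one (x : V) : twist (1 : lipschitzGroup Q) x = x := by
  apply ι_inj Q
  rw [ι_twist, OneMemClass.coe_one, map_one, inv_one, Units.val_one, mul_one]
  exact one_mul _

theorem twist_mul (p q : lipschitzGroup Q) (x : V) : twist (p * q) x = twist p (twist q x) := by
  apply ι_inj Q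
  simp only [ι_twist, elt, Subgroup.coe_mul, map_mul, mul_inv_rev, Units.val_mul, mul_assoc]

theorem map_twist (p : lipschitzGroup Q) (x : V) : Q (twist p x) = Q x := by
  have h1 := ι_twist p x
  have h2 : ι Q (twist p x) = ↑(involuteUnits Q p) * ι Q x * ↑(p : (CliffordAlgebra Q)ˣ)⁻¹ := by
    have h := congrArg involute h1
    have hi : involute (↑(involuteUnits Q p)⁻¹ : CliffordAlgebra Q)
        = ↑(p : (CliffordAlgebra Q)ˣ)⁻¹ := by
      change (↑(involuteUnits Q (involuteUnits Q p)⁻¹) : CliffordAlgebra Q) = _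
      rw [map_inv]
      congr 2
      exact Units.ext (involute_involute _)
    rw [map_mul, map_mul, involute_ι, involute_ι, hi, mul_neg, neg_mul, neg_inj] at h
    exact h
  apply algebraMap_inj Q
  rw [← ι_sq_scalar, ← ι_sq_scalar]
  nth_rewrite 1 [h2]
  rw [h1]
  simp only [mul_assoc, Units.inv_mul_cancel_left]
  rw [← mul_assoc (ι Q x), ι_sq_scalar, Algebra.left_comm, Units.mul_inv, mul_one]

theorem mul_ι_of_mem_radical {x : V} (hx : x ∈ polarRadical Q) (m : CliffordAlgebra Q) :
    m * ι Q x = ι Q x * involute m := by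
  induction m using CliffordAlgebra.induction with
  | algebraMap r => rw [AlgHom.commutes, Algebra.commutes]
  | ι v =>
    have h : QuadraticMap.polar Q x v = 0 := LinearMap.congr_fun (LinearMap.mem_ker.mp hx) v
    rw [involute_ι, mul_neg, ι_mul_ι_eq_neg h, neg_neg]
  | mul a b ha hb => rw [mul_assoc, hb, ← mul_assoc, ha, map_mul, mul_assoc]
  | add a b ha hb => rw [add_mul, ha, hb, map_add, mul_add]

theorem twist_of_mem_radical (p : lipschitzGroup Q) {x : V} (hx : x ∈ polarRadical Q) :
    twist p x = x := by
  apply ι_inj Q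
  rw [ι_twist, mul_ι_of_mem_radical hx, mul_assoc, ← coe_involuteUnits, Units.mul_inv, mul_one]

/-- The linear bijection `x ↦ p x σ(p)⁻¹` of `V`. -/
def twistEquiv (p : lipschitzGroup Q) : V ≃ₗ[F] V where
  toFun := twist p
  invFun := twist p⁻¹
  map_add' x y := by
    apply ι_inj Q
    simp only [ι_twist, map_add, mul_add, add_mul]
  map_smul' c x := by
    apply ι_inj Q
    simp only [ι_twist, map_smul, mul_smul_comm, smul_mul_assoc, RingHom.id_apply]
  left_inv x := by rw [← twist_mul, inv_mul_cancel, twist_one]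
  right_inv x := by rw [← twist_mul, mul_inv_cancel, twist_one]

variable (Q)

/-- The twisted adjoint representation `p ↦ (x ↦ p x σ(p)⁻¹)` of the Lipschitz group. -/
def twistedAdjoint : lipschitzGroup Q →* weakOrthogonalGroup Q where
  toFun p := ⟨twistEquiv p, map_twist p, fun _ hx => twist_of_mem_radical p hx⟩
  map_one' := Subtype.ext (LinearEquiv.ext twist_one)
  map_mul' p q := Subtype.ext (LinearEquiv.ext (twist_mul p q))

variable {Q}

theorem ι_twistedAdjoint (p : lipschitzGroup Q) (x : V) :
    ι Q ((twistedAdjoint Q p : V ≃ₗ[F] V) x) = elt p * ι Q x * ↑(involuteUnits Q p)⁻¹ :=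
  ι_twist p x

/-! ### The point group and its action on the projective space -/

variable (Q)

/-- The subgroup `F ∖ {0}` of the Lipschitz group. -/
def scalarUnits : Subgroup (lipschitzGroup Q) where
  carrier := {p | ∃ c : F, elt p = algebraMap F _ c}
  one_mem' := ⟨1, (map_one _).symm⟩
  mul_mem' := by
    rintro a b ⟨c, hc⟩ ⟨d, hd⟩
    exact ⟨c * d, by rw [map_mul, ← hc, ← hd]; rfl⟩
  inv_mem' := by
    rintro a ⟨c, hc⟩
    have hc0 : c ≠ 0 := by
      rintro rfl
      exact a.1.ne_zero (hc.trans (map_zero _))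
    refine ⟨c⁻¹, ?_⟩
    change (↑(a : (CliffordAlgebra Q)ˣ)⁻¹ : CliffordAlgebra Q) = _
    rw [Units.inv_eq_of_mul_eq_one_right]
    change elt a * _ = 1
    rw [hc, ← map_mul, mul_inv_cancel₀ hc0, map_one]

instance scalarUnits_normal : (scalarUnits Q).Normal where
  conj_mem := by
    rintro n ⟨c, hc⟩ g
    refine ⟨c, ?_⟩
    change elt g * elt n * ↑(g : (CliffordAlgebra Q)ˣ)⁻¹ = _
    rw [hc, ← Algebra.commutes, mul_assoc, Units.mul_inv, mul_one]

/-- The set of all points `F p` of the projective space on the Clifford algebra, where `p` ranges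
over the Lipschitz group. -/
def pointGroup : Set (ℙ F (CliffordAlgebra Q)) :=
  {P | ∃ p : lipschitzGroup Q, P = Projectivization.mk F (elt p) p.1.ne_zero}

variable {Q}

/-- The point `F p`. -/
def pt (p : lipschitzGroup Q) : pointGroup Q :=
  ⟨Projectivization.mk F (elt p) p.1.ne_zero, p, rfl⟩

theorem pt_surjective : Function.Surjective (pt : lipschitzGroup Q → pointGroup Q) := by
  rintro ⟨_, p, rfl⟩
  exact ⟨p, rfl⟩

theorem pt_eq_pt_iff (p q : lipschitzGroup Q) : pt p = pt q ↔ p⁻¹ * q ∈ scalarUnits Q := by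
  rw [Subtype.ext_iff]
  refine (Projectivization.mk_eq_mk_iff' F _ _ p.1.ne_zero q.1.ne_zero).trans ?_
  constructor
  · rintro ⟨a, ha⟩
    have ha0 : a ≠ 0 := by
      rintro rfl
      rw [zero_smul] at ha
      exact p.1.ne_zero ha.symm
    refine ⟨a⁻¹, ?_⟩
    change (↑(p : (CliffordAlgebra Q)ˣ)⁻¹ : CliffordAlgebra Q) * elt q = _
    rw [Units.inv_mul_eq_iff_eq_mul, ← ha, ← Algebra.commutes, ← Algebra.smul_def,
      inv_smul_smul₀ ha0]
  · rintro ⟨c, hc⟩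
    change (↑(p : (CliffordAlgebra Q)ˣ)⁻¹ : CliffordAlgebra Q) * elt q = _ at hc
    rw [Units.inv_mul_eq_iff_eq_mul, ← Algebra.commutes, ← Algebra.smul_def] at hc
    have hc0 : c ≠ 0 := by
      rintro rfl
      rw [zero_smul] at hc
      exact q.1.ne_zero hc
    refine ⟨c⁻¹, ?_⟩
    change c⁻¹ • elt q = elt p
    rw [hc, inv_smul_smul₀ hc0]

variable (Q)

/-- The canonical bijection from the quotient of the Lipschitz group by `F ∖ {0}` onto the set of
points `F p`. -/
def quotientEquiv : (lipschitzGroup Q ⧸ scalarUnits Q) ≃ pointGroup Q :=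
  Equiv.ofBijective
    (Quotient.lift pt fun p q h => (pt_eq_pt_iff p q).2 (QuotientGroup.leftRel_apply.mp h))
    ⟨by
      rintro ⟨p⟩ ⟨q⟩ h
      exact QuotientGroup.eq.2 ((pt_eq_pt_iff p q).1 h), by
      intro P
      obtain ⟨p, rfl⟩ := pt_surjective P
      exact ⟨QuotientGroup.mk p, rfl⟩⟩

/-- The group structure on the set of points `F p`; see `pt_mul` for the multiplication. -/
instance pointGroupGroup : Group (pointGroup Q) := (quotientEquiv Q).symm.group

/-- The canonical isomorphism of groups. -/
def quotientMulEquiv : (lipschitzGroup Q ⧸ scalarUnits Q) ≃* pointGroup Q :=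
  ((quotientEquiv Q).symm.mulEquiv).symm

variable {Q}

theorem quotientMulEquiv_mk (p : lipschitzGroup Q) :
    quotientMulEquiv Q (QuotientGroup.mk p) = pt p := rfl

theorem pt_one : pt (1 : lipschitzGroup Q) = 1 := rfl

/-- The multiplication is `(F p) (F q) = F (p q)`. -/
theorem pt_mul (p q : lipschitzGroup Q) : pt p * pt q = pt (p * q) := by
  rw [← quotientMulEquiv_mk, ← quotientMulEquiv_mk, ← map_mul]
  rfl

variable (Q)

/-- The points of `pointGroup Q` that are contained in the even (`i = 0`) or odd (`i = 1`) part of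
the Clifford algebra. -/
def gradedPoints (i : ZMod 2) : Set (pointGroup Q) :=
  {P | (P : ℙ F (CliffordAlgebra Q)).submodule ≤ evenOdd Q i}

theorem scalarUnits_le_ker : scalarUnits Q ≤ (twistedAdjoint Q).ker := by
  rintro p ⟨c, hc⟩
  refine Subtype.ext (LinearEquiv.ext fun x => ι_inj Q ?_)
  have hs : involuteUnits Q p = p := by
    apply Units.ext
    rw [coe_involuteUnits]
    change involute (elt p) = elt p
    rw [hc, AlgHom.commutes]
  rw [ι_twistedAdjoint, hs, hc, Algebra.commutes, mul_assoc, ← hc, Units.mul_inv, mul_one]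
  rfl

/-- The homomorphism `θ` that sends a point `F p` to the class of `x ↦ p x σ(p)⁻¹` in the
projective weak orthogonal group. -/
def theta : pointGroup Q →* ProjWeakOrthogonalGroup Q :=
  (QuotientGroup.lift (scalarUnits Q)
    ((QuotientGroup.mk' (weakScalars Q)).comp (twistedAdjoint Q))
    (fun p hp => by
      rw [MonoidHom.mem_ker, MonoidHom.comp_apply, MonoidHom.mem_ker.mp (scalarUnits_le_ker Q hp),
        map_one])).comp
    (quotientMulEquiv Q).symm.toMonoidHom

variable {Q}

theorem theta_pt (p : lipschitzGroup Q) :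
    theta Q (pt p) = QuotientGroup.mk (twistedAdjoint Q p) := by
  rw [← quotientMulEquiv_mk, theta, MonoidHom.comp_apply]
  exact congrArg _ ((quotientMulEquiv Q).symm_apply_apply _)

/-- A vector `r` with `Q r ≠ 0`, as an element of the Lipschitz group. -/
def regularVector (r : V) (hr : Q r ≠ 0) : lipschitzGroup Q :=
  ⟨⟨ι Q r, ι Q ((Q r)⁻¹ • r),
    by rw [map_smul, mul_smul_comm, ι_sq_scalar, Algebra.smul_def, ← map_mul,
      inv_mul_cancel₀ hr, map_one],
    by rw [map_smul, smul_mul_assoc, ι_sq_scalar, Algebra.smul_def, ← map_mul,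
      inv_mul_cancel₀ hr, map_one]⟩,
    Submonoid.subset_closure (Or.inl (Or.inr ⟨r, rfl⟩))⟩

end ProjMetric

end

open ProjMetric

/-! Two facts about ξ : p ↦ ξ_p carry the theorem: ξ maps the Lipschitz group onto the weak
orthogonal group (`twistedAdjoint_surjective`), and its kernel lies in the subalgebra generated by
the radical (`mem_cliffordSubalgebra_radical`). Both hold in every characteristic and for every
radical.

Kernel: ξ_p = id means p x = x σ(p) for all x, and this says that the contractions of p along all
forms B(x,·) vanish. These are precisely the linear forms that vanish on the radical, so p involves
radical vectors only. If the radical is F r, then p = a + b r, and since p is even or odd, only a or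
b r survives. A multiple of r is invertible only if Q(r) ≠ 0, which separates (a) from (d).

Surjectivity: for a weak isometry φ ≠ id there is some ξ_p that fixes all fixed vectors of φ and
agrees with φ on a vector that φ moves. Then ξ_p⁻¹ φ has more fixed vectors than φ, and induction on
the codimension of the fixed space applies.

As the radical is nonzero, -id is a weak isometry only if it is id, so passing to the projective
group loses nothing. The statements on even points follow by parity: F r in the kernel turns odd
points into even ones with the same image, whereas a trivial kernel keeps the image of an odd point
out of the image of the even ones. -/

namespace ProjMetric

open CliffordAlgebra

/-! ### The kernel of the twisted adjoint representation, via contractions -/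

section Kernel

variable {F V : Type*} [Field F] [AddCommGroup V] [Module F V] {Q : QuadraticForm F V}

/-- Both sides are σ-twisted derivations in `m` that agree on vectors. This translates the
commutation rule defining the kernel into the vanishing of contractions. -/
theorem contractLeft_polarBilin (x : V) (m : CliffordAlgebra Q) :
    contractLeft (Q.polarBilin x) m = ι Q x * m - involute m * ι Q x := by
  induction m using CliffordAlgebra.left_induction with
  | algebraMap c => rw [contractLeft_algebraMap, AlgHom.commutes, Algebra.commutes, sub_self]
  | add a b ha hb => rw [map_add, ha, hb, map_add]; noncomm_ring
  | ι_mul m a h =>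
    have hxa : ι Q x * ι Q a = algebraMap F _ (QuadraticMap.polar Q x a) - ι Q a * ι Q x :=
      eq_sub_of_add_eq (ι_mul_ι_add_swap x a)
    rw [contractLeft_ι_mul, h, map_mul, involute_ι, ← mul_assoc, hxa, sub_mul, Algebra.smul_def,
      QuadraticMap.polarBilin_apply_apply]
    noncomm_ring

variable (Q) in
/-- The subalgebra of the Clifford algebra generated by a subspace `W` of `V`. -/
def cliffordSubalgebra (W : Submodule F V) : Subalgebra F (CliffordAlgebra Q) :=
  Algebra.adjoin F (ι Q '' W)

theorem ι_mem_cliffordSubalgebra {W : Submodule F V} {x : V} (hx : x ∈ W) :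
    ι Q x ∈ cliffordSubalgebra Q W :=
  Algebra.subset_adjoin ⟨x, hx, rfl⟩

theorem cliffordSubalgebra_top : cliffordSubalgebra Q ⊤ = ⊤ := by
  rw [cliffordSubalgebra, Submodule.top_coe, Set.image_univ, adjoin_range_ι]

theorem cliffordSubalgebra_bot : cliffordSubalgebra Q ⊥ = ⊥ := by
  simp [cliffordSubalgebra]

/-- With A the subalgebra of `W'`, the space A + e A contains 1 and is stable under left
multiplication by `W`, because w e = B(w,e) - e w and e² = Q(e) allow every e to be moved to the
front and reduced. -/
theorem cliffordSubalgebra_normal_form {W W' : Submodule F V} {e : V}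
    (hW : ∀ x ∈ W, ∃ c : F, x - c • e ∈ W') {m : CliffordAlgebra Q}
    (hm : m ∈ cliffordSubalgebra Q W) :
    ∃ a ∈ cliffordSubalgebra Q W', ∃ b ∈ cliffordSubalgebra Q W', m = a + ι Q e * b := by
  let S : Submodule F (CliffordAlgebra Q) :=
    Subalgebra.toSubmodule (cliffordSubalgebra Q W') ⊔
      (Subalgebra.toSubmodule (cliffordSubalgebra Q W')).map (LinearMap.mulLeft F (ι Q e))
  have hS : ∀ k, k ∈ S ↔ ∃ a ∈ cliffordSubalgebra Q W', ∃ b ∈ cliffordSubalgebra Q W',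
      k = a + ι Q e * b := by
    intro k
    simp [S, Submodule.mem_sup, eq_comm]
  -- Stability of `S` under `m`, unlike membership of `m` in `S`, passes to products; membership is
  -- the case k = 1.
  have hmul : ∀ k ∈ S, m * k ∈ S := by
    induction hm using Algebra.adjoin_induction with
    | mem x hx =>
      obtain ⟨x, hx, rfl⟩ := hx
      obtain ⟨c, hc⟩ := hW x hx
      intro k hk
      obtain ⟨a, ha, b, hb, rfl⟩ := (hS k).1 hk
      obtain ⟨w, rfl⟩ : ∃ w, x = w + c • e := ⟨x - c • e, by abel⟩
      rw [add_sub_cancel_right] at hc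
      have hwA := ι_mem_cliffordSubalgebra (Q := Q) hc
      have h1 : ι Q w * (a + ι Q e * b) ∈ S := by
        refine (hS _).2 ⟨ι Q w * a + algebraMap F _ (QuadraticMap.polar Q w e) * b,
          add_mem (mul_mem hwA ha) (mul_mem (algebraMap_mem _ _) hb), -(ι Q w * b),
          neg_mem (mul_mem hwA hb), ?_⟩
        rw [← ι_mul_ι_add_swap]
        noncomm_ring
      have h2 : ι Q e * (a + ι Q e * b) ∈ S := by
        refine (hS _).2 ⟨algebraMap F _ (Q e) * b, mul_mem (algebraMap_mem _ _) hb, a, ha, ?_⟩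
        rw [← ι_sq_scalar]
        noncomm_ring
      rw [map_add, map_smul, add_mul, smul_mul_assoc]
      exact add_mem h1 (S.smul_mem c h2)
    | algebraMap c =>
      intro k hk
      rw [← Algebra.smul_def]
      exact S.smul_mem c hk
    | add a b _ _ ha hb =>
      intro k hk
      rw [add_mul]
      exact add_mem (ha k hk) (hb k hk)
    | mul a b _ _ ha hb =>
      intro k hk
      rw [mul_assoc]
      exact ha _ (hb k hk)
  have h1 : (1 : CliffordAlgebra Q) ∈ S := (hS 1).2 ⟨1, one_mem _, 0, zero_mem _, by simp⟩
  simpa using (hS _).1 (hmul 1 h1)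

theorem contractLeft_eq_zero_of_mem_cliffordSubalgebra {W : Submodule F V} {d : Module.Dual F V}
    (hd : W ≤ LinearMap.ker d) {m : CliffordAlgebra Q} (hm : m ∈ cliffordSubalgebra Q W) :
    contractLeft d m = 0 := by
  -- Again a form that passes to products; the claim is the case k = 1.
  have hmul : ∀ k, contractLeft d k = 0 → contractLeft d (m * k) = 0 := by
    induction hm using Algebra.adjoin_induction with
    | mem x hx =>
      obtain ⟨x, hx, rfl⟩ := hx
      intro k hk
      rw [contractLeft_ι_mul, hk, LinearMap.mem_ker.mp (hd hx), zero_smul, mul_zero, sub_zero]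
    | algebraMap c =>
      intro k hk
      rw [contractLeft_algebraMap_mul, hk, mul_zero]
    | add a b _ _ ha hb =>
      intro k hk
      rw [add_mul, map_add, ha k hk, hb k hk, add_zero]
    | mul a b _ _ ha hb =>
      intro k hk
      rw [mul_assoc]
      exact ha _ (hb k hk)
  simpa using hmul 1 (contractLeft_one Q d)

theorem mem_cliffordSubalgebra_inf_ker {W : Submodule F V} {d : Module.Dual F V} {e : V}
    (he : e ∈ W) (hde : d e = 1) {m : CliffordAlgebra Q} (hm : m ∈ cliffordSubalgebra Q W)
    (hdm : contractLeft d m = 0) : m ∈ cliffordSubalgebra Q (W ⊓ LinearMap.ker d) := by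
  obtain ⟨a, ha, b, hb, rfl⟩ :=
    cliffordSubalgebra_normal_form (W' := W ⊓ LinearMap.ker d) (e := e)
      (fun x hx => ⟨d x, sub_mem hx (W.smul_mem _ he), by simp [hde]⟩) hm
  -- The contraction of a + e b along `d` is d(e) b = b, since `a` and `b` are themselves killed.
  have hb0 : b = 0 := by
    rw [map_add, contractLeft_ι_mul, contractLeft_eq_zero_of_mem_cliffordSubalgebra inf_le_right ha,
      contractLeft_eq_zero_of_mem_cliffordSubalgebra inf_le_right hb, hde] at hdm
    simpa using hdm
  rwa [hb0, mul_zero, add_zero]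

/-- An element of the Clifford algebra that is killed by all contractions along linear forms
vanishing on `U` lies in the subalgebra generated by `U`. -/
theorem mem_cliffordSubalgebra_of_contractLeft_eq_zero [FiniteDimensional F V] (U : Submodule F V)
    {m : CliffordAlgebra Q}
    (h : ∀ d : Module.Dual F V, U ≤ LinearMap.ker d → contractLeft d m = 0) :
    m ∈ cliffordSubalgebra Q U := by
  suffices H : ∀ (n : ℕ) (W : Submodule F V), Module.finrank F W = n → U ≤ W →
      m ∈ cliffordSubalgebra Q W → m ∈ cliffordSubalgebra Q U from
    H _ ⊤ rfl le_top (by rw [cliffordSubalgebra_top]; trivial)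
  intro n
  induction n using Nat.strong_induction_on with
  | _ n ih =>
    intro W hn hUW hm
    obtain hWU | hWU := em (W ≤ U)
    · rwa [le_antisymm hUW hWU]
    obtain ⟨w, hwW, hwU⟩ := SetLike.not_le_iff_exists.mp hWU
    -- Cutting `W` down by a form that vanishes on `U` but not at `w` lowers the dimension and keeps
    -- `m` in the subalgebra.
    obtain ⟨f, hf, hUf⟩ := Submodule.exists_le_ker_of_notMem hwU
    have hd : U ≤ LinearMap.ker ((f w)⁻¹ • f) := fun x hx => by
      simp [LinearMap.mem_ker.mp (hUf hx)]
    refine ih _ ?_ (W ⊓ LinearMap.ker ((f w)⁻¹ • f)) rfl (le_inf hUW hd)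
      (mem_cliffordSubalgebra_inf_ker hwW (by simp [hf]) hm (h _ hd))
    rw [← hn]
    refine Submodule.finrank_lt_finrank_of_lt (lt_of_le_not_ge inf_le_left fun hle => ?_)
    simpa [hf] using LinearMap.mem_ker.mp (hle hwW).2

variable (Q) in
-- The range of a dual map is the annihilator of the kernel; as B is symmetric, its dual map is B
-- itself once V is identified with its bidual.
theorem exists_polarBilin_eq [FiniteDimensional F V] {f : Module.Dual F V}
    (hf : polarRadical Q ≤ LinearMap.ker f) : ∃ w, Q.polarBilin w = f := by
  have h : f ∈ (LinearMap.ker Q.polarBilin).dualAnnihilator :=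
    (Submodule.mem_dualAnnihilator f).2 fun x hx => hf hx
  rw [← LinearMap.range_dualMap_eq_dualAnnihilator_ker] at h
  obtain ⟨g, rfl⟩ := h
  obtain ⟨w, rfl⟩ := (Module.evalEquiv F V).surjective g
  refine ⟨w, LinearMap.ext fun x => ?_⟩
  simp [QuadraticMap.polar_comm]

/-- An element `p` of the Clifford algebra with `p x = x σ(p)` for all vectors `x` lies in the
subalgebra generated by the radical. -/
theorem mem_cliffordSubalgebra_radical [FiniteDimensional F V] {p : CliffordAlgebra Q}
    (hp : ∀ x, p * ι Q x = ι Q x * involute p) : p ∈ cliffordSubalgebra Q (polarRadical Q) := by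
  apply mem_cliffordSubalgebra_of_contractLeft_eq_zero
  intro d hd
  obtain ⟨x, rfl⟩ := exists_polarBilin_eq Q hd
  -- Applying σ turns p x = x σ(p) into σ(p) x = x p, which is the vanishing of the contraction.
  have h := congrArg involute (hp x)
  rw [map_mul, map_mul, involute_ι, involute_involute, mul_neg, neg_mul, neg_inj] at h
  rw [contractLeft_polarBilin, h, sub_self]

theorem exists_eq_add_of_mem_cliffordSubalgebra_span {r : V} {p : CliffordAlgebra Q}
    (hp : p ∈ cliffordSubalgebra Q (Submodule.span F {r})) :
    ∃ a b : F, p = algebraMap F _ a + b • ι Q r := by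
  obtain ⟨a, ha, b, hb, rfl⟩ :=
    cliffordSubalgebra_normal_form (W' := (⊥ : Submodule F V)) (e := r) (fun x hx => by
      obtain ⟨c, rfl⟩ := Submodule.mem_span_singleton.mp hx
      exact ⟨c, by simp⟩) hp
  rw [cliffordSubalgebra_bot] at ha hb
  obtain ⟨a, rfl⟩ := ha
  obtain ⟨b, rfl⟩ := hb
  refine ⟨a, b, ?_⟩
  rw [Algebra.smul_def, Algebra.commutes b]
  rfl

end Kernel

/-! ### Surjectivity of the twisted adjoint representation -/

section Surjectivity

variable {F V : Type*} [Field F] [AddCommGroup V] [Module F V] {Q : QuadraticForm F V}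

theorem twistedAdjoint_eq_of_mul {p : lipschitzGroup Q} {x y : V}
    (h : elt p * ι Q x = ι Q y * involute (elt p)) :
    (twistedAdjoint Q p : V ≃ₗ[F] V) x = y := by
  apply ι_inj Q
  rw [ι_twistedAdjoint, h, mul_assoc, ← coe_involuteUnits, Units.mul_inv, mul_one]

theorem mul_ι_of_twistedAdjoint_eq_one {p : lipschitzGroup Q} (hp : twistedAdjoint Q p = 1)
    (x : V) : elt p * ι Q x = ι Q x * involute (elt p) := by
  have h := ι_twistedAdjoint p x
  rw [hp] at h
  change ι Q x = _ at h
  nth_rewrite 2 [h]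
  rw [mul_assoc, ← coe_involuteUnits, Units.inv_mul, mul_one]

/-- This is the reflection in `v`: the sign in σ(v) = -v cancels the one from v x = B(v,x) - x v. -/
theorem twistedAdjoint_regularVector {v : V} (hv : Q v ≠ 0) (x : V) :
    (twistedAdjoint Q (regularVector v hv) : V ≃ₗ[F] V) x
      = x - (QuadraticMap.polar Q v x / Q v) • v := by
  apply twistedAdjoint_eq_of_mul
  change ι Q v * ι Q x = _ * involute (ι Q v)
  rw [involute_ι, map_sub, map_smul, mul_neg, sub_mul, smul_mul_assoc, ι_sq_scalar,
    Algebra.smul_def,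
    ← (algebraMap F (CliffordAlgebra Q)).map_mul, div_mul_cancel₀ _ hv, ← ι_mul_ι_add_swap]
  noncomm_ring

/-- The element `1 + s t` of the Lipschitz group. -/
def siegelElement (s t : V) (hs : Q s = 0) (ht : Q t = 0) (hst : QuadraticMap.polar Q s t = 0) :
    lipschitzGroup Q :=
  -- As s t squares to zero, 1 - s t inverts 1 + s t.
  have h : ι Q s * ι Q t * (ι Q s * ι Q t) = 0 := by
    nth_rewrite 2 [ι_mul_ι_eq_neg hst]
    rw [mul_neg, mul_assoc, ← mul_assoc (ι Q t), ι_mul_self_eq_zero ht, zero_mul, mul_zero,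
      neg_zero]
  ⟨⟨1 + ι Q s * ι Q t, 1 - ι Q s * ι Q t,
    by rw [mul_sub, mul_one, add_mul, h]; simp,
    by rw [mul_add, mul_one, sub_mul, h]; simp⟩,
    Submonoid.subset_closure (Or.inr ⟨s, t, hs, ht, hst, rfl⟩)⟩

theorem twistedAdjoint_siegelElement {s t : V} (hs : Q s = 0) (ht : Q t = 0)
    (hst : QuadraticMap.polar Q s t = 0) (x : V) :
    (twistedAdjoint Q (siegelElement s t hs ht hst) : V ≃ₗ[F] V) x
      = x + QuadraticMap.polar Q t x • s - QuadraticMap.polar Q s x • t := by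
  apply twistedAdjoint_eq_of_mul
  change (1 + ι Q s * ι Q t) * ι Q x = _ * involute (1 + ι Q s * ι Q t)
  have e1 : ι Q s * ι Q t * ι Q x = algebraMap F _ (QuadraticMap.polar Q t x) * ι Q s
      - algebraMap F _ (QuadraticMap.polar Q s x) * ι Q t + ι Q x * (ι Q s * ι Q t) := by
    rw [Algebra.commutes, ← ι_mul_ι_add_swap, ← ι_mul_ι_add_swap]
    noncomm_ring
  have e2 : ι Q s * (ι Q s * ι Q t) = 0 := by rw [← mul_assoc, ι_mul_self_eq_zero hs, zero_mul]
  have e3 : ι Q t * (ι Q s * ι Q t) = 0 := by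
    rw [ι_mul_ι_eq_neg hst, mul_neg, ← mul_assoc, ι_mul_self_eq_zero ht, zero_mul, neg_zero]
  simp only [map_add, map_sub, map_smul, map_mul, map_one, involute_ι, neg_mul_neg, mul_add,
    add_mul, sub_mul, smul_mul_assoc, e2, e3, e1, smul_zero, mul_one, one_mul, add_zero, sub_zero]
  simp only [Algebra.smul_def]
  abel

/-- Transvections along singular vectors of the radical come from the Lipschitz group. -/
theorem exists_twistedAdjoint_eq_transvection {r : V} (hr : r ∈ polarRadical Q) (hQr : Q r = 0)
    (w : V) : ∃ p : lipschitzGroup Q, ∀ x,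
      (twistedAdjoint Q p : V ≃ₗ[F] V) x = x + QuadraticMap.polar Q w x • r := by
  have hrp : ∀ x, QuadraticMap.polar Q r x = 0 := fun x =>
    LinearMap.congr_fun (LinearMap.mem_ker.mp hr) x
  by_cases hw : Q w = 0
  · refine ⟨siegelElement r w hQr hw (hrp w), fun x => ?_⟩
    rw [twistedAdjoint_siegelElement, hrp, zero_smul, sub_zero]
  -- For regular `w` the transvection is the product of the reflections in w and w - Q(w) r, which
  -- have the same Q-value and the same polar form.
  · have hwr : Q (w - Q w • r) = Q w := by
      rw [sub_eq_add_neg, QuadraticMap.map_add Q, QuadraticMap.polar_comm, ← neg_smul,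
        QuadraticMap.polar_smul_left, hrp, QuadraticMap.map_smul, hQr]
      simp
    have hwr0 : Q (w - Q w • r) ≠ 0 := by rwa [hwr]
    have hp : ∀ x, QuadraticMap.polar Q (w - Q w • r) x = QuadraticMap.polar Q w x := by
      intro x
      rw [QuadraticMap.polar_sub_left, QuadraticMap.polar_smul_left, hrp, smul_zero, sub_zero]
    have hpr : QuadraticMap.polar Q w r = 0 := by rw [QuadraticMap.polar_comm, hrp]
    have hpw : QuadraticMap.polar Q w w = 2 * Q w := by
      rw [QuadraticMap.polar_self]; simp
    refine ⟨regularVector w hw * regularVector _ hwr0, fun x => ?_⟩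
    rw [map_mul, Subgroup.coe_mul, LinearEquiv.mul_apply, twistedAdjoint_regularVector,
      twistedAdjoint_regularVector, hwr, hp, QuadraticMap.polar_sub_right,
      QuadraticMap.polar_smul_right, QuadraticMap.polar_sub_right, QuadraticMap.polar_smul_right,
      hpr, hpw]
    simp only [smul_eq_mul]
    match_scalars <;> field_simp
    ring

/-- A nontrivial weak isometry agrees, on its fixed vectors and on a vector that it moves, with an
isometry coming from the Lipschitz group. -/
theorem exists_twistedAdjoint_agree [FiniteDimensional F V] {φ : V ≃ₗ[F] V}
    (hφ : φ ∈ weakOrthogonalGroup Q) (hne : φ ≠ 1) :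
    ∃ (p : lipschitzGroup Q) (x : V), φ x ≠ x ∧ (twistedAdjoint Q p : V ≃ₗ[F] V) x = φ x ∧
      ∀ y, φ y = y → (twistedAdjoint Q p : V ≃ₗ[F] V) y = y := by
  obtain ⟨hQ, hR⟩ := hφ
  have hB : ∀ x y, QuadraticMap.polar Q (φ x) (φ y) = QuadraticMap.polar Q x y := fun x y => by
    simp only [QuadraticMap.polar, ← map_add, hQ]
  have hfix : ∀ x y, φ y = y → QuadraticMap.polar Q (φ x - x) y = 0 := by
    intro x y hy
    have h := hB x y
    rw [hy] at h
    rw [QuadraticMap.polar_sub_left, h, sub_self]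
  have hself : ∀ x, QuadraticMap.polar Q x x = 2 * Q x := fun x => by
    rw [QuadraticMap.polar_self]; simp
  have hQs : ∀ x, QuadraticMap.polar Q (φ x - x) x = -Q (φ x - x) := by
    intro x
    have h := QuadraticMap.map_add Q (φ x - x) x
    rw [sub_add_cancel, hQ] at h
    linear_combination -h
  -- Since B(φx - x, x) = -Q(φx - x), the reflection in a regular φx - x takes x to φx.
  by_cases h1 : ∃ x, Q (φ x - x) ≠ 0
  · obtain ⟨x, hx⟩ := h1
    refine ⟨regularVector _ hx, x, fun h => hx (by rw [h, sub_self, map_zero]), ?_, fun y hy => ?_⟩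
    · rw [twistedAdjoint_regularVector, hQs, neg_div, div_self hx]
      simp
    · rw [twistedAdjoint_regularVector, hfix x y hy]
      simp
  push Not at h1
  have hQ0 : ∀ x, QuadraticMap.polar Q (φ x - x) x = 0 := fun x => by rw [hQs, h1, neg_zero]
  have hs0 : ∀ x y, QuadraticMap.polar Q (φ x - x) (φ y - y) = 0 := by
    intro x y
    have h := h1 (x + y)
    have e : φ (x + y) - (x + y) = (φ x - x) + (φ y - y) := by rw [map_add]; abel
    rw [e, QuadraticMap.map_add Q, h1, h1] at h
    simpa using h
  -- Now φ - id has totally singular image, so (x, y) ↦ B(φx - x, y) is alternating.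
  have hskew : ∀ x y, QuadraticMap.polar Q (φ y - y) x = -QuadraticMap.polar Q (φ x - x) y := by
    intro x y
    have h := hs0 x y
    have h2 := hB x y
    simp only [QuadraticMap.polar_sub_left, QuadraticMap.polar_sub_right] at h ⊢
    rw [QuadraticMap.polar_comm Q (φ y) x, QuadraticMap.polar_comm Q y x]
    linear_combination h2 - h
  by_cases h2 : ∃ x y, QuadraticMap.polar Q (φ x - x) y ≠ 0
  · obtain ⟨x, y, hc⟩ := h2
    set c := QuadraticMap.polar Q (φ x - x) y with hcdef
    -- The factor -c⁻¹ cancels B(φy - y, x) = -c, so that x is moved by exactly φx - x.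
    refine ⟨siegelElement ((-c⁻¹) • (φ x - x)) (φ y - y)
      (by rw [QuadraticMap.map_smul, h1, smul_zero]) (h1 y)
      (by rw [QuadraticMap.polar_smul_left, hs0, smul_zero]), x, ?_, ?_, fun z hz => ?_⟩
    · intro h
      rw [h, sub_self] at hcdef
      exact hc (by simpa using hcdef)
    · rw [twistedAdjoint_siegelElement, hskew x y, ← hcdef, QuadraticMap.polar_smul_left, hQ0,
        smul_smul, neg_mul_neg, mul_inv_cancel₀ hc]
      simp
    · rw [twistedAdjoint_siegelElement, hfix y z hz, QuadraticMap.polar_smul_left, hfix x z hz]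
      simp
  -- Last case: φ - id maps into the radical, and a transvection along φx - x suffices.
  push Not at h2
  obtain ⟨x, hx⟩ : ∃ x, φ x ≠ x := by
    by_contra! h
    exact hne (LinearEquiv.ext h)
  have hrad : φ x - x ∈ polarRadical Q := LinearMap.mem_ker.mpr (LinearMap.ext (h2 x))
  obtain ⟨f, hf, hker⟩ := Submodule.exists_le_ker_of_notMem
    (p := LinearMap.ker ((φ : V →ₗ[F] V) - LinearMap.id)) (v := x)
    (fun h => hx (sub_eq_zero.mp (LinearMap.mem_ker.mp h)))
  have hmem : ∀ y, φ y = y → f y = 0 := fun y hy =>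
    hker (LinearMap.mem_ker.mpr (sub_eq_zero.mpr hy))
  -- The form vanishes on the radical because φ fixes the radical.
  obtain ⟨w, rfl⟩ := exists_polarBilin_eq Q (f := f) fun y hy => hmem y (hR y hy)
  obtain ⟨p, hp⟩ := exists_twistedAdjoint_eq_transvection hrad (h1 x)
    ((QuadraticMap.polar Q w x)⁻¹ • w)
  have hf' : QuadraticMap.polar Q w x ≠ 0 := hf
  refine ⟨p, x, hx, ?_, fun y hy => ?_⟩
  · rw [hp, QuadraticMap.polar_smul_left, smul_eq_mul, inv_mul_cancel₀ hf']
    simp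
  · have : QuadraticMap.polar Q w y = 0 := hmem y hy
    rw [hp, QuadraticMap.polar_smul_left, this]
    simp

variable (Q) in
theorem twistedAdjoint_surjective [FiniteDimensional F V] :
    Function.Surjective (twistedAdjoint Q) := by
  suffices H : ∀ (n : ℕ) (φ : weakOrthogonalGroup Q), Module.finrank F V -
      Module.finrank F (LinearMap.ker (((φ : V ≃ₗ[F] V) : V →ₗ[F] V) - LinearMap.id)) = n →
      ∃ p, twistedAdjoint Q p = φ from fun φ => H _ φ rfl
  intro n
  induction n using Nat.strong_induction_on with
  | _ n ih =>
    intro φ hn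
    by_cases hφ : (φ : V ≃ₗ[F] V) = 1
    · exact ⟨1, by rw [map_one]; exact (Subtype.ext hφ).symm⟩
    obtain ⟨p, x, hx, hpx, hfix⟩ := exists_twistedAdjoint_agree φ.2 hφ
    have hψ : ∀ y z, (twistedAdjoint Q p : V ≃ₗ[F] V) z = (φ : V ≃ₗ[F] V) y →
        (((twistedAdjoint Q p)⁻¹ * φ : weakOrthogonalGroup Q) : V ≃ₗ[F] V) y = z := by
      intro y z h
      change (twistedAdjoint Q p : V ≃ₗ[F] V).symm ((φ : V ≃ₗ[F] V) y) = z
      rw [← h, LinearEquiv.symm_apply_apply]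
    have hlt : LinearMap.ker (((φ : V ≃ₗ[F] V) : V →ₗ[F] V) - LinearMap.id) <
        LinearMap.ker (((((twistedAdjoint Q p)⁻¹ * φ : weakOrthogonalGroup Q) :
          V ≃ₗ[F] V) : V →ₗ[F] V) - LinearMap.id) := by
      refine lt_of_le_not_ge (fun y hy => ?_) fun hle => ?_
      · have hy : (φ : V ≃ₗ[F] V) y = y := sub_eq_zero.mp (LinearMap.mem_ker.mp hy)
        exact LinearMap.mem_ker.mpr (sub_eq_zero.mpr (hψ y y (by rw [hfix y hy, hy])))
      · exact hx (sub_eq_zero.mp (LinearMap.mem_ker.mp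
          (hle (LinearMap.mem_ker.mpr (sub_eq_zero.mpr (hψ x x hpx))))))
    have h1 := Submodule.finrank_lt_finrank_of_lt hlt
    have h2 := Submodule.finrank_le (LinearMap.ker (((((twistedAdjoint Q p)⁻¹ * φ :
      weakOrthogonalGroup Q) : V ≃ₗ[F] V) : V →ₗ[F] V) - LinearMap.id))
    obtain ⟨q, hq⟩ := ih _ (by omega) ((twistedAdjoint Q p)⁻¹ * φ) rfl
    exact ⟨p * q, by rw [map_mul, hq, mul_inv_cancel_left]⟩

variable (Q) in
theorem theta_surjective [FiniteDimensional F V] : Function.Surjective (theta Q) := by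
  intro φ
  obtain ⟨φ, rfl⟩ := QuotientGroup.mk_surjective φ
  obtain ⟨p, rfl⟩ := twistedAdjoint_surjective Q φ
  exact ⟨pt p, theta_pt p⟩

end Surjectivity

/-! ### Parity of points and the kernel of θ -/

section PointGroup

variable {F V : Type*} [Field F] [AddCommGroup V] [Module F V] {Q : QuadraticForm F V}

theorem pt_mem_gradedPoints {p : lipschitzGroup Q} {i : ZMod 2} :
    pt p ∈ gradedPoints Q i ↔ elt p ∈ evenOdd Q i := by
  change (Projectivization.mk F (elt p) p.1.ne_zero).submodule ≤ _ ↔ _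
  rw [Projectivization.submodule_mk, Submodule.span_singleton_le_iff_mem]

theorem eq_zero_of_mem_even_of_mem_odd {m : CliffordAlgebra Q} (h0 : m ∈ evenOdd Q 0)
    (h1 : m ∈ evenOdd Q 1) : m = 0 :=
  Submodule.disjoint_def.mp (evenOdd_isCompl Q).disjoint m h0 h1

theorem pt_eq_pt_of_smul {p q : lipschitzGroup Q} {c : F} (h : elt p = c • elt q) :
    pt p = pt q :=
  Subtype.ext ((Projectivization.mk_eq_mk_iff' F _ _ p.1.ne_zero q.1.ne_zero).2 ⟨c, h.symm⟩)

theorem pt_one_mem_gradedPoints : pt (1 : lipschitzGroup Q) ∈ gradedPoints Q 0 :=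
  pt_mem_gradedPoints.2 (Submodule.one_le.mp (one_le_evenOdd_zero Q))

theorem pt_regularVector_mem_gradedPoints {r : V} (hr : Q r ≠ 0) :
    pt (regularVector r hr) ∈ gradedPoints Q 1 :=
  pt_mem_gradedPoints.2 (ι_mem_evenOdd_one Q r)

theorem disjoint_gradedPoints {P : pointGroup Q} (h0 : P ∈ gradedPoints Q 0)
    (h1 : P ∈ gradedPoints Q 1) : False := by
  obtain ⟨p, rfl⟩ := pt_surjective P
  exact p.1.ne_zero
    (eq_zero_of_mem_even_of_mem_odd (pt_mem_gradedPoints.1 h0) (pt_mem_gradedPoints.1 h1))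

theorem mem_gradedPoints_zero_or_one (P : pointGroup Q) :
    P ∈ gradedPoints Q 0 ∨ P ∈ gradedPoints Q 1 := by
  obtain ⟨p, rfl⟩ := pt_surjective P
  exact (lipschitz_homogeneous p.2).imp pt_mem_gradedPoints.2 pt_mem_gradedPoints.2

/-- If the radical is nonzero then `-id` belongs to the weak orthogonal group only if it equals
`id`. -/
theorem weakScalars_eq_bot {r : V} (hr : r ∈ polarRadical Q) (hr0 : r ≠ 0) :
    weakScalars Q = ⊥ := by
  rw [eq_bot_iff]
  rintro φ (h | h)
  · exact Subtype.ext (LinearEquiv.ext h)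
  · have h2 : (2 : F) • r = 0 := by
      rw [two_smul]
      nth_rewrite 2 [← φ.2.2 r hr]
      rw [h r, add_neg_cancel]
    have h20 : (2 : F) = 0 := (smul_eq_zero.mp h2).resolve_right hr0
    refine Subtype.ext (LinearEquiv.ext fun x => (h x).trans ?_)
    have : x + x = 0 := by rw [← two_smul F x, h20, zero_smul]
    exact neg_eq_of_add_eq_zero_left this

theorem mem_ker_theta_iff {r : V} (hr : r ∈ polarRadical Q) (hr0 : r ≠ 0) (p : lipschitzGroup Q) :
    pt p ∈ (theta Q).ker ↔ twistedAdjoint Q p = 1 := by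
  rw [MonoidHom.mem_ker, theta_pt, QuotientGroup.eq_one_iff, weakScalars_eq_bot hr hr0,
    Subgroup.mem_bot]

/-- If the radical is the line `F r`, then the only possible elements of the kernel of the twisted
adjoint representation are multiples of `1` and of `r`. -/
theorem exists_smul_of_twistedAdjoint_eq_one [FiniteDimensional F V] {r : V}
    (hspan : polarRadical Q = Submodule.span F {r}) {p : lipschitzGroup Q}
    (hp : twistedAdjoint Q p = 1) :
    (∃ c : F, elt p = c • 1) ∨ ∃ c : F, elt p = c • ι Q r := by
  have hmem := mem_cliffordSubalgebra_radical (mul_ι_of_twistedAdjoint_eq_one hp)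
  rw [hspan] at hmem
  obtain ⟨a, b, hab⟩ := exists_eq_add_of_mem_cliffordSubalgebra_span hmem
  rw [Algebra.algebraMap_eq_smul_one] at hab
  have ha : a • (1 : CliffordAlgebra Q) ∈ evenOdd Q 0 :=
    Submodule.smul_mem _ _ (Submodule.one_le.mp (one_le_evenOdd_zero Q))
  have hb : b • ι Q r ∈ evenOdd Q 1 := Submodule.smul_mem _ _ (ι_mem_evenOdd_one Q r)
  obtain h | h := lipschitz_homogeneous p.2
  · have : b • ι Q r = 0 := eq_zero_of_mem_even_of_mem_odd (by
      rw [← add_sub_cancel_left (a • 1) (b • ι Q r), ← hab]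
      exact sub_mem h ha) hb
    exact Or.inl ⟨a, by rw [hab, this, add_zero]⟩
  · have : a • (1 : CliffordAlgebra Q) = 0 := eq_zero_of_mem_even_of_mem_odd ha (by
      rw [← add_sub_cancel_right (a • 1) (b • ι Q r), ← hab]
      exact sub_mem h hb)
    exact Or.inr ⟨b, by rw [hab, this, zero_add]⟩

theorem ker_theta_of_singular_radical [FiniteDimensional F V] {r : V} (hr0 : r ≠ 0)
    (hspan : polarRadical Q = Submodule.span F {r}) (hQr : Q r = 0) :
    ((theta Q).ker : Set (pointGroup Q)) = {pt 1} := by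
  have hr : r ∈ polarRadical Q := hspan ▸ Submodule.mem_span_singleton_self r
  ext P
  obtain ⟨p, rfl⟩ := pt_surjective P
  rw [SetLike.mem_coe, mem_ker_theta_iff hr hr0, Set.mem_singleton_iff]
  constructor
  · intro hp
    obtain ⟨c, hc⟩ | ⟨c, hc⟩ := exists_smul_of_twistedAdjoint_eq_one hspan hp
    · exact pt_eq_pt_of_smul hc
    -- A multiple of a singular vector squares to zero and is no unit.
    · have h : elt p * elt p = 0 := by
        rw [hc, smul_mul_smul_comm, ι_mul_self_eq_zero hQr, smul_zero]
      exact absurd ((Units.mul_right_eq_zero _).1 h) p.1.ne_zero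
  · intro h
    rw [← mem_ker_theta_iff hr hr0, h, pt_one]
    exact one_mem _

theorem ker_theta_of_regular_radical [FiniteDimensional F V] {r : V}
    (hspan : polarRadical Q = Submodule.span F {r}) (hQr : Q r ≠ 0) :
    ((theta Q).ker : Set (pointGroup Q)) = {pt 1, pt (regularVector r hQr)} := by
  have hr : r ∈ polarRadical Q := hspan ▸ Submodule.mem_span_singleton_self r
  have hr0 : r ≠ 0 := by
    rintro rfl
    exact hQr (map_zero Q)
  ext P
  obtain ⟨p, rfl⟩ := pt_surjective P
  rw [SetLike.mem_coe, Set.mem_insert_iff, Set.mem_singleton_iff]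
  constructor
  · intro hp
    rw [mem_ker_theta_iff hr hr0] at hp
    obtain ⟨c, hc⟩ | ⟨c, hc⟩ := exists_smul_of_twistedAdjoint_eq_one hspan hp
    · exact Or.inl (pt_eq_pt_of_smul hc)
    · exact Or.inr (pt_eq_pt_of_smul hc)
  · rintro (h | h)
    · rw [h, pt_one]
      exact one_mem _
    · rw [h, mem_ker_theta_iff hr hr0]
      -- The reflection in a regular radical vector is the identity.
      refine Subtype.ext (LinearEquiv.ext fun x => ?_)
      rw [twistedAdjoint_regularVector,
        show QuadraticMap.polar Q r x = 0 from LinearMap.congr_fun (LinearMap.mem_ker.mp hr) x]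
      simp

end PointGroup

end ProjMetric

/-! ### The theorem for a one-dimensional radical -/

theorem theorem5p2 {F V : Type*} [Field F] [AddCommGroup V] [Module F V] [FiniteDimensional F V]
    (Q : QuadraticForm F V) (hrad : Module.finrank F (polarRadical Q) = 1) :
    Function.Surjective (theta Q) ∧
    (Q '' (polarRadical Q : Set V) = {0} →
      ((theta Q).ker : Set (pointGroup Q)) = {pt 1}) ∧
    (Q '' (polarRadical Q : Set V) = {0} → Module.finrank F V = 1 →
      gradedPoints Q 0 = Set.univ) ∧
    (Q '' (polarRadical Q : Set V) = {0} → 1 < Module.finrank F V →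
      theta Q '' gradedPoints Q 0 ≠ Set.univ) ∧
    (Q '' (polarRadical Q : Set V) ≠ {0} →
      (∃ r ∈ polarRadical Q, ∃ hr : Q r ≠ 0,
        ((theta Q).ker : Set (pointGroup Q)) = {pt 1, pt (regularVector r hr)} ∧
        pt 1 ≠ pt (regularVector r hr) ∧
        pt 1 ∈ gradedPoints Q 0 ∧
        pt (regularVector r hr) ∈ gradedPoints Q 1) ∧
      theta Q '' gradedPoints Q 0 = Set.univ) := by
  obtain ⟨⟨r, hr⟩, hr0, hgen⟩ := finrank_eq_one_iff'.mp hrad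
  have hr0 : r ≠ 0 := fun h => hr0 (Subtype.ext h)
  have hspan : polarRadical Q = Submodule.span F {r} := by
    refine le_antisymm (fun x hx => ?_) ((Submodule.span_singleton_le_iff_mem _ _).2 hr)
    obtain ⟨c, hc⟩ := hgen ⟨x, hx⟩
    exact Submodule.mem_span_singleton.2 ⟨c, congrArg Subtype.val hc⟩
  have hsing : Q '' (polarRadical Q : Set V) = {0} → Q r = 0 := fun h => by
    simpa [h] using Set.mem_image_of_mem Q (show r ∈ (polarRadical Q : Set V) from hr)
  have hker := fun h => ker_theta_of_singular_radical hr0 hspan (hsing h)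
  refine ⟨theta_surjective Q, hker, fun h hV => ?_, fun h hV himg => ?_, fun h => ?_⟩
  · refine Set.eq_univ_of_forall fun P => ?_
    have htop : polarRadical Q = ⊤ := Submodule.eq_top_of_finrank_eq (hrad.trans hV.symm)
    obtain ⟨p, rfl⟩ := pt_surjective P
    have hp : pt p ∈ ((theta Q).ker : Set (pointGroup Q)) :=
      (mem_ker_theta_iff hr hr0 p).2 (Subtype.ext (LinearEquiv.ext fun x =>
        (twistedAdjoint Q p).2.2 x (htop ▸ Submodule.mem_top)))
    rw [hker h, Set.mem_singleton_iff] at hp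
    rw [hp]
    exact pt_one_mem_gradedPoints
  -- If Q were zero, the radical would be V. An even point with the image of the odd point F v would
  -- equal F v, as θ is injective here.
  · obtain ⟨v, hv⟩ : ∃ v, Q v ≠ 0 := by
      by_contra! hQ
      have htop : polarRadical Q = ⊤ := by
        refine Submodule.eq_top_iff'.2 fun x => LinearMap.mem_ker.2 (LinearMap.ext fun y => ?_)
        simp [QuadraticMap.polar, hQ]
      rw [htop, finrank_top] at hrad
      omega
    obtain ⟨P, hP, hPv⟩ : theta Q (pt (regularVector v hv)) ∈ theta Q '' gradedPoints Q 0 :=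
      himg ▸ Set.mem_univ _
    have hmem : P⁻¹ * pt (regularVector v hv) ∈ ((theta Q).ker : Set (pointGroup Q)) := by
      rw [SetLike.mem_coe, MonoidHom.mem_ker, map_mul, map_inv, hPv, inv_mul_cancel]
    rw [hker h, Set.mem_singleton_iff, pt_one, inv_mul_eq_one] at hmem
    exact disjoint_gradedPoints hP (hmem ▸ pt_regularVector_mem_gradedPoints hv)
  · have hQr : Q r ≠ 0 := fun hQr => h (by
      refine Set.eq_singleton_iff_unique_mem.2 ⟨⟨0, zero_mem _, map_zero Q⟩, ?_⟩
      rintro _ ⟨x, hx, rfl⟩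
      rw [hspan] at hx
      obtain ⟨c, rfl⟩ := Submodule.mem_span_singleton.1 hx
      rw [QuadraticMap.map_smul, hQr, smul_zero])
    have hkr := ker_theta_of_regular_radical hspan hQr
    refine ⟨⟨r, hr, hQr, hkr, fun heq => ?_, pt_one_mem_gradedPoints,
      pt_regularVector_mem_gradedPoints hQr⟩, Set.eq_univ_of_forall fun φ => ?_⟩
    · exact disjoint_gradedPoints pt_one_mem_gradedPoints
        (heq ▸ pt_regularVector_mem_gradedPoints hQr)
    · obtain ⟨P, rfl⟩ := theta_surjective Q φ
      obtain hP | hP := mem_gradedPoints_zero_or_one P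
      · exact ⟨P, hP, rfl⟩
      · have hrk : pt (regularVector r hQr) ∈ (theta Q).ker := by
          rw [← SetLike.mem_coe, hkr]
          exact Or.inr rfl
        -- Multiplying by F r changes the parity of the point but not its image.
        refine ⟨P * pt (regularVector r hQr), ?_, by
          rw [map_mul, MonoidHom.mem_ker.1 hrk, mul_one]⟩
        obtain ⟨p, rfl⟩ := pt_surjective P
        rw [pt_mul]
        refine pt_mem_gradedPoints.2 ?_
        exact (show (1 : ZMod 2) + 1 = 0 by decide) ▸ CliffordAlgebra.evenOdd_mul_le Q 1 1
          (Submodule.mul_mem_mul (pt_mem_gradedPoints.1 hP)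
            (CliffordAlgebra.ι_mem_evenOdd_one Q r))
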